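/- Let $q$ be an indeterminate, and for $n\ge 0$ put $[n]_q=(q^n-1)/(q-1)$. Let $(\beta_n)_{n\ge 0}$ be the Carlitz $q$-Bernoulli numbers, i.e. the rational functions $\beta_n\in\mathbb{Q}(q)$ determined by $$q\sum_{k=0}^{n}\binom{n}{k}q^k\beta_k-\beta_n=\begin{cases}q-1&\text{if } n=0,\\ 1&\text{if } n=1,\\ 0&\text{if } n>1,\end{cases}$$ and let $\widehat{B}(x)=\sum_{n\ge 0}\beta_n x^n\in\mathbb{Q}(q)[[x]]$ be their ordinary generating function. Then $\widehat{B}(x)$ has the continued fraction expansion $$\widehat{B}(x)=\cfrac{1}{[1]_q+\cfrac{x}{\frac{q+1}{[1]_q}-\cfrac{x}{[3]_q+\cfrac{q[2]_q x}{\frac{q^2+1}{[2]_q}-\cfrac{[2]_q x}{[5]_q+\cfrac{q^2[3]_q x}{\frac{q^3+1}{[3]_q}-\cfrac{[3]_q x}{\ddots}}}}}}},$$ that is, $\widehat B(x)=\cfrac{a_0}{b_0+\cfrac{a_1}{b_1+\cfrac{a_2}{b_2+\cdots}}}$ with $a_0=1$, $a_{2n-1}=q^{n-1}[n]_q\,x$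 and $a_{2n}=-[n]_q\,x$ for $n\ge 1$, $b_{2n}=[2n+1]_q$ for $n\ge 0$, and $b_{2n-1}=(q^n+1)/[n]_q$ for $n\ge 1$. Equivalently, in normalized form, $$\widehat{B}(x)=\cfrac{1}{1+\cfrac{c_1x}{1+\cfrac{c_2x}{1+\cfrac{c_3x}{\ddots}}}},\qquad c_{2n-1}=\frac{q^{n-1}[n]_q^2}{(q^n+1)[2n-1]_q},\quad c_{2n}=-\frac{[n]_q^2}{(q^n+1)[2n+1]_q}\qquad(n\ge 1).$$ Both equalities mean that the successive finite truncations of the continued fraction, computed in $\mathbb{Q}(q)((x))$, converge $x$-adically to $\widehat{B}(x)$. -/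

import Mathlib

open scoped LaurentSeries Topology

noncomputable section

namespace QBernoulli

/-- The field `ℚ(q)` of rational functions in one indeterminate `q`. -/
abbrev Qq : Type := RatFunc ℚ

/-- The indeterminate `q` of `ℚ(q)`. -/
abbrev q : Qq := RatFunc.X

/-- The `q`-integer `[n]_q = (q^n - 1) / (q - 1)`. -/
def qInt (n : ℕ) : Qq := (q ^ n - 1) / (q - 1)

/-- The right-hand side of the defining relations of the Carlitz `q`-Bernoulli numbers. -/
def betaRhs (n : ℕ) : Qq := if n = 0 then q - 1 else if n = 1 then 1 else 0

/-- The Carlitz `q`-Bernoulli numbers: the relation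
`q * ∑_{k ≤ n} (n choose k) q^k β_k - β_n = betaRhs n`, solved for `β_n`
(see `beta_relation` and `eq_beta_of_relation`). -/
def beta (n : ℕ) : Qq :=
  (betaRhs n - q * ∑ k : Fin n, (n.choose k : Qq) * q ^ (k : ℕ) * beta k) / (q ^ (n + 1) - 1)
termination_by n
decreasing_by exact k.isLt

theorem q_pow_sub_one_ne_zero (n : ℕ) : (q ^ (n + 1) - 1 : Qq) ≠ 0 := by
  intro h
  have h1 : (algebraMap (Polynomial ℚ) Qq) (Polynomial.X ^ (n + 1) - 1) = 0 := by
    simpa [RatFunc.algebraMap_X] using h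
  have h2 := (FaithfulSMul.algebraMap_eq_zero_iff (Polynomial ℚ) Qq).mp h1
  exact Polynomial.X_pow_sub_C_ne_zero (Nat.succ_pos n) (1 : ℚ) (by simpa using h2)

/-- The umbral relation `q (q β + 1)^n - β^n = betaRhs n`, expanded. -/
theorem beta_relation (n : ℕ) :
    q * ∑ k ∈ Finset.range (n + 1), (n.choose k : Qq) * q ^ k * beta k - beta n = betaRhs n := by
  have h0 := q_pow_sub_one_ne_zero n
  have h : beta n * (q ^ (n + 1) - 1)
      = betaRhs n - q * ∑ k ∈ Finset.range n, (n.choose k : Qq) * q ^ k * beta k := by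
    rw [beta, div_mul_cancel₀ _ h0,
      Finset.sum_range (fun k => (n.choose k : Qq) * q ^ k * beta k)]
  rw [Finset.sum_range_succ, Nat.choose_self, Nat.cast_one]
  linear_combination h

/-- The umbral relations determine the Carlitz `q`-Bernoulli numbers. -/
theorem eq_beta_of_relation (b : ℕ → Qq)
    (hb : ∀ n, q * ∑ k ∈ Finset.range (n + 1), (n.choose k : Qq) * q ^ k * b k - b n
      = betaRhs n) (n : ℕ) : b n = beta n := by
  induction n using Nat.strong_induction_on with
  | _ n ih =>
    have h1 := hb n
    have h2 := beta_relation n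
    rw [Finset.sum_range_succ, Nat.choose_self, Nat.cast_one] at h1 h2
    have h3 : ∑ k ∈ Finset.range n, (n.choose k : Qq) * q ^ k * b k
        = ∑ k ∈ Finset.range n, (n.choose k : Qq) * q ^ k * beta k :=
      Finset.sum_congr rfl fun k hk => by rw [ih k (Finset.mem_range.mp hk)]
    rw [h3] at h1
    have h4 : (b n - beta n) * (q ^ (n + 1) - 1) = 0 := by linear_combination h1 - h2
    exact sub_eq_zero.mp ((mul_eq_zero.mp h4).resolve_right (q_pow_sub_one_ne_zero n))

/-- The ordinary generating function `∑ β_n x^n`, as an element of `ℚ(q)((x))`. -/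
def Bhat : Qq⸨X⸩ := ((PowerSeries.mk beta : PowerSeries Qq) : Qq⸨X⸩)

/-- The variable `x` of `ℚ(q)((x))`. -/
def x : Qq⸨X⸩ := ((PowerSeries.X : PowerSeries Qq) : Qq⸨X⸩)

/-- The continued fraction `a 0 / (b 0 + a 1 / (b 1 + a 2 / (b 2 + ⋯)))`. -/
def contFrac (a b : ℕ → Qq⸨X⸩) : GenContFract Qq⸨X⸩ :=
  ⟨0, Stream'.Seq.ofStream fun n => ⟨a n, b n⟩⟩

/-- `f` is the value of the formal continued fraction `g`: the convergents of `g` converge to `f`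
in the `x`-adic topology of `ℚ(q)((x))`. -/
def HasValue (g : GenContFract Qq⸨X⸩) (f : Qq⸨X⸩) : Prop :=
  Filter.Tendsto (fun n => g.convs n) Filter.atTop (𝓝 f)

/-- The S-fraction `1 / (1 + c 1 x / (1 + c 2 x / (1 + ⋯)))`. The value `c 0` is not used. -/
def sFrac (c : ℕ → Qq) : GenContFract Qq⸨X⸩ :=
  contFrac (fun m => if m = 0 then 1 else HahnSeries.C (c m) * x) (fun _ => 1)

/-- The coefficient `c_{2n-1} = q^{n-1} [n]^2 / ((q^n+1) [2n-1])`, for `n ≥ 1`. -/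
def sOdd (n : ℕ) : Qq := q ^ (n - 1) * qInt n ^ 2 / ((q ^ n + 1) * qInt (2 * n - 1))

/-- The coefficient `c_{2n} = -[n]^2 / ((q^n+1) [2n+1])`, for `n ≥ 1`. -/
def sEven (n : ℕ) : Qq := -(qInt n ^ 2 / ((q ^ n + 1) * qInt (2 * n + 1)))

/-- The S-fraction coefficients `c_m`, for `m ≥ 1`. -/
def sCoeff (m : ℕ) : Qq :=
  if Odd m then sOdd ((m + 1) / 2) else sEven (m / 2)

theorem sCoeff_odd (n : ℕ) (hn : 1 ≤ n) : sCoeff (2 * n - 1) = sOdd n := by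
  have h1 : Odd (2 * n - 1) := ⟨n - 1, by omega⟩
  have h2 : (2 * n - 1 + 1) / 2 = n := by omega
  rw [sCoeff, if_pos h1, h2]

theorem sCoeff_even (n : ℕ) : sCoeff (2 * n) = sEven n := by
  have h1 : ¬ Odd (2 * n) := by simp
  have h2 : 2 * n / 2 = n := by omega
  rw [sCoeff, if_neg h1, h2]

/-- Partial numerators of the unnormalized fraction: `1` at `0`, then `q^{n-1} [n] x` at `2n-1`
and `-[n] x` at `2n`, for `n ≥ 1`. -/
def partNum (m : ℕ) : Qq⸨X⸩ :=
  if m = 0 then 1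
  else if Odd m then HahnSeries.C (q ^ ((m + 1) / 2 - 1) * qInt ((m + 1) / 2)) * x
  else HahnSeries.C (-qInt (m / 2)) * x

/-- Partial denominators of the unnormalized fraction: `(q^n+1) / [n]` at `2n-1` for `n ≥ 1`, and
`[2n+1]` at `2n` for `n ≥ 0`. -/
def partDen (m : ℕ) : Qq⸨X⸩ :=
  if Odd m then HahnSeries.C ((q ^ ((m + 1) / 2) + 1) / qInt ((m + 1) / 2))
  else HahnSeries.C (qInt (m + 1))

end QBernoulli

end

/-!
Let `L` be the linear functional on `ℚ(q)[X]` with `L (X^n) = β_n`. The relations that define the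
`β_n` say that `q L (f (1 + q X)) - L f = (q - 1) f 0 + f' 0` (`umbral_comp`). With `X = [m]` the
substitution is the shift `m ↦ m + 1`, so this evaluates `L` on the `q`-falling factorials
`ψ_j = X (X - [1]) ⋯ (X - [j-1])`: one finds `L ψ_j = (-1)^j [j]! / [j+1]` (`umbral_qFalling`).

Let `d_n` be the denominator of the `n`-th convergent of the S-fraction, written as a reversed
polynomial. The functionals `f ↦ L (d_n f)` obey a three-term recurrence in `n`, which is solved on
the `ψ_j` in closed form (`functional_qFalling`). The closed forms are products containing the
factors `q^j - q^i`, with `0 ≤ i < m` for `n = 2m` and `1 ≤ i ≤ m` for `n = 2m + 1`. Their zeros give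
the orthogonality relations `L (d_{2m} X^k) = 0` and `L (d_{2m+1} X^{k+1}) = 0` for `k < m`
(`evenFunctional_X_pow`, `oddFunctional_X_pow_succ`), since `X ψ_j = ψ_{j+1} + [j] ψ_j`.

The remainder `B̂ · (denominator) - (numerator)` of the `n`-th convergent is the generating function
of the moments of that functional, up to a power of `x` (`remainder_eq`), so orthogonality makes it
divisible by `x^n` (`exists_remainder_eq`). The denominators are power series with constant term
`1`; hence the `n`-th convergent agrees with `B̂` modulo `x^n`, which is `x`-adic convergence. The
unnormalized fraction has the same convergents, by an equivalence transformation
(`contFrac_convs_eq`).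
-/

noncomputable section

namespace QBernoulli

/-! ### The umbral functional and its functional equation -/

open Polynomial in
/-- The linear functional on `ℚ(q)[X]` whose moments are the Carlitz `q`-Bernoulli numbers. -/
def umbral : Qq[X] →ₗ[Qq] Qq :=
  Polynomial.lsum fun n => LinearMap.toSpanSingleton Qq Qq (beta n)

open Polynomial in
theorem umbral_X_pow (n : ℕ) : umbral (X ^ n) = beta n := by
  simp [umbral, ← Polynomial.monomial_one_right_eq_X_pow, Polynomial.lsum_apply]

theorem q_sub_one_ne_zero : (q - 1 : Qq) ≠ 0 := by
  simpa using q_pow_sub_one_ne_zero 0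

theorem qInt_zero : qInt 0 = 0 := by simp [qInt]

theorem qInt_one : qInt 1 = 1 := by simp [qInt, div_self q_sub_one_ne_zero]

theorem qInt_succ (n : ℕ) : qInt (n + 1) = 1 + q * qInt n := by
  have h := q_sub_one_ne_zero
  simp only [qInt]
  field_simp
  ring

theorem qInt_succ_ne_zero (n : ℕ) : qInt (n + 1) ≠ 0 :=
  div_ne_zero (q_pow_sub_one_ne_zero n) q_sub_one_ne_zero

theorem q_pow_add_one_ne_zero (n : ℕ) : (q ^ (n + 1) + 1 : Qq) ≠ 0 := by
  intro h
  apply q_pow_sub_one_ne_zero (2 * n + 1)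
  have : (q ^ (2 * n + 1 + 1) - 1 : Qq) = (q ^ (n + 1) + 1) * (q ^ (n + 1) - 1) := by ring
  rw [this, h, zero_mul]

open Polynomial in
/-- The umbral functional equation: the defining relations of the `β_n`, extended linearly from
monomials to all polynomials. -/
theorem umbral_comp (p : Qq[X]) :
    q * umbral (p.comp (1 + C q * X)) - umbral p
      = (q - 1) * p.coeff 0 + p.coeff 1 := by
  induction p using Polynomial.induction_on' with
  | add f g hf hg =>
    simp only [add_comp, map_add, coeff_add]
    linear_combination hf + hg
  | monomial n a =>
    have h1 : umbral ((monomial n a).comp (1 + C q * X))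
        = a * ∑ k ∈ Finset.range (n + 1), (n.choose k : Qq) * q ^ k * beta k := by
      rw [monomial_comp, add_comm, add_pow, ← smul_eq_C_mul, map_smul, map_sum, smul_eq_mul]
      congr 1
      refine Finset.sum_congr rfl fun k _ => ?_
      have : (C q * X) ^ k * 1 ^ (n - k) * ((n.choose k : ℕ) : Qq[X])
          = ((n.choose k : Qq) * q ^ k) • X ^ k := by
        rw [smul_eq_C_mul, mul_pow]
        simp only [one_pow, mul_one, map_mul, map_pow, map_natCast]
        ring
      rw [this, map_smul, umbral_X_pow, smul_eq_mul]
    have h2 : umbral (monomial n a) = a * beta n := by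
      rw [← mul_one a, ← smul_eq_mul, ← smul_monomial, monomial_one_right_eq_X_pow, map_smul,
        umbral_X_pow, smul_eq_mul, smul_eq_mul, mul_one]
    have h3 := beta_relation n
    rw [h1, h2, coeff_monomial, coeff_monomial]
    have h4 : (q - 1) * (if n = 0 then a else 0) + (if n = 1 then a else 0) = a * betaRhs n := by
      unfold betaRhs
      split_ifs <;> first | omega | ring
    rw [h4, ← h3]
    ring

/-! ### Values on `q`-falling factorials -/

open Polynomial in
/-- The `q`-falling factorial `X (X - [1]) ⋯ (X - [j-1])`. -/
def qFalling (j : ℕ) : Qq[X] := ∏ i ∈ Finset.range j, (X - C (qInt i))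

open Polynomial in
theorem qFalling_zero : qFalling 0 = 1 := by simp [qFalling]

open Polynomial in
theorem qFalling_one : qFalling 1 = X := by simp [qFalling, qInt_zero]

open Polynomial in
theorem X_mul_qFalling (j : ℕ) :
    X * qFalling j = qFalling (j + 1) + qInt j • qFalling j := by
  rw [qFalling, qFalling, Finset.prod_range_succ, smul_eq_C_mul]
  ring

open Polynomial in
/-- With `X = [m]`, the substitution `X ↦ 1 + q X` is the shift `m ↦ m + 1`, whence a `q`-Pascal
rule for `q`-falling factorials. -/
theorem qFalling_succ_comp (n : ℕ) :
    (qFalling (n + 1)).comp (1 + C q * X)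
      = q ^ (n + 1) • qFalling (n + 1) + (q ^ n * qInt (n + 1)) • qFalling n := by
  -- Each factor `X - [i+1]` becomes `q (X - [i])`, and the factor `X` becomes `1 + q X`.
  have h (m : ℕ) : (qFalling (m + 1)).comp (1 + C q * X)
      = (1 + C q * X) * (C (q ^ m) * qFalling m) := by
    induction m with
    | zero => simp [qFalling_one, qFalling_zero]
    | succ m ih =>
      have e (k : ℕ) : qFalling (k + 1) = qFalling k * (X - C (qInt k)) := by
        simp [qFalling, Finset.prod_range_succ]
      rw [e (m + 1), mul_comp, ih, e m, qInt_succ]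
      simp only [sub_comp, add_comp, mul_comp, one_comp, X_comp, C_comp, map_add, map_mul, map_one,
        map_pow]
      ring
  rw [h, smul_eq_C_mul, smul_eq_C_mul, qInt_succ, qFalling, qFalling, Finset.prod_range_succ]
  simp only [map_add, map_mul, map_one, map_pow]
  ring

/-- The values of the umbral functional on `q`-falling factorials (see `umbral_qFalling`),
namely `(-1)^j [j]! / [j+1]`. -/
def umbralFalling (j : ℕ) : Qq := (∏ i ∈ Finset.range j, -qInt (i + 1)) / qInt (j + 1)

theorem umbralFalling_succ (j : ℕ) :
    umbralFalling (j + 1) = -(qInt (j + 1) ^ 2 / qInt (j + 2)) * umbralFalling j := by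
  have h := qInt_succ_ne_zero j
  have h' := qInt_succ_ne_zero (j + 1)
  rw [umbralFalling, umbralFalling, Finset.prod_range_succ]
  field_simp

open Polynomial in
theorem umbral_qFalling (j : ℕ) : umbral (qFalling j) = umbralFalling j := by
  induction j with
  | zero =>
    have h := beta_relation 0
    have h1 := q_sub_one_ne_zero
    have h2 : umbral 1 = beta 0 := by simpa using umbral_X_pow 0
    have h3 : beta 0 * (q - 1) = 1 * (q - 1) := by
      simp [betaRhs] at h
      linear_combination h
    simpa [qFalling_zero, umbralFalling, qInt_one, h2] using mul_right_cancel₀ h1 h3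
  | succ n ih =>
    have h := umbral_comp (qFalling (n + 1))
    -- Splitting off the factor `X` shows the coefficients of degrees `0` and `1`.
    have h0 : qFalling (n + 1) = X * ∏ i ∈ Finset.range n, (X - C (qInt (i + 1))) := by
      rw [qFalling, Finset.prod_range_succ']
      simp [qInt_zero, mul_comm]
    have c0 : (qFalling (n + 1)).coeff 0 = 0 := by simp [h0]
    have c1 : (qFalling (n + 1)).coeff 1 = ∏ i ∈ Finset.range n, -qInt (i + 1) := by
      rw [h0, coeff_X_mul, coeff_zero_eq_eval_zero, eval_prod]
      simp
    have hn := qInt_succ_ne_zero n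
    have hp : (∏ i ∈ Finset.range n, -qInt (i + 1)) = qInt (n + 1) * umbralFalling n := by
      rw [umbralFalling]
      field_simp
    rw [qFalling_succ_comp, map_add, map_smul, map_smul, ih, c0, c1, hp] at h
    simp only [smul_eq_mul] at h
    rw [umbralFalling_succ]
    have h1 := q_sub_one_ne_zero
    have h2 := q_pow_sub_one_ne_zero (n + 1)
    apply mul_right_cancel₀ h2
    have h3 : umbral (qFalling (n + 1)) * (q ^ (n + 1 + 1) - 1)
        = (1 - q ^ (n + 1)) * qInt (n + 1) * umbralFalling n := by
      linear_combination h
    rw [h3]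
    simp only [qInt]
    have h2' : (q ^ (n + 2) - 1 : Qq) ≠ 0 := h2
    field_simp
    ring

/-! ### The closed-form ratio and its shift in `j` -/

/-- The product `∏_{i=1}^m (q^j - q^i) / (q^{j+i+1} - 1)`. -/
def oddRatio (m j : ℕ) : Qq :=
  ∏ i ∈ Finset.range m, (q ^ j - q ^ (i + 1)) / (q ^ j * q ^ (i + 2) - 1)

theorem oddRatio_zero (j : ℕ) : oddRatio 0 j = 1 := by simp [oddRatio]

theorem oddRatio_succ (m j : ℕ) : oddRatio (m + 1) j
    = oddRatio m j * ((q ^ j - q ^ (m + 1)) / (q ^ j * q ^ (m + 2) - 1)) :=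
  Finset.prod_range_succ _ _

theorem q_pow_mul_sub_one_ne_zero (j m : ℕ) : (q ^ j * q ^ (m + 1) - 1 : Qq) ≠ 0 := by
  rw [← pow_add]
  exact q_pow_sub_one_ne_zero (j + m)

/-- Raising `j` by one telescopes the product. The right side uses `oddRatio m j` and not
`oddRatio (m + 1) j`, as the latter vanishes at `j = m + 1`. -/
theorem oddRatio_succ_succ (m j : ℕ) : oddRatio (m + 1) (j + 1)
    = oddRatio m j * (q ^ (m + 1) * (q ^ j - 1) * (q ^ j * q ^ 2 - 1)
      / ((q ^ j * q ^ (m + 2) - 1) * (q ^ j * q ^ (m + 3) - 1))) := by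
  induction m with
  | zero =>
    have h2 := q_pow_mul_sub_one_ne_zero j 1
    have h3 := q_pow_mul_sub_one_ne_zero j 2
    have h4 := q_pow_mul_sub_one_ne_zero (j + 1) 1
    rw [oddRatio_succ, oddRatio_zero, oddRatio_zero, one_mul, one_mul,
      div_eq_div_iff h4 (mul_ne_zero h2 h3)]
    ring
  | succ m ih =>
    have h2 := q_pow_mul_sub_one_ne_zero j (m + 1)
    have h3 := q_pow_mul_sub_one_ne_zero j (m + 2)
    have h4 := q_pow_mul_sub_one_ne_zero j (m + 3)
    have h5 : (q ^ (j + 1) * q ^ (m + 1 + 2) - 1 : Qq) = q ^ j * q ^ (m + 4) - 1 := by ring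
    rw [oddRatio_succ, ih, oddRatio_succ, h5]
    field_simp
    ring

theorem oddRatio_eq_zero {m j : ℕ} (hj : 1 ≤ j) (hjm : j ≤ m) : oddRatio m j = 0 := by
  refine Finset.prod_eq_zero (i := j - 1) (Finset.mem_range.mpr (by omega)) ?_
  rw [Nat.sub_add_cancel hj, sub_self, zero_div]

/-! ### The functionals attached to the denominators -/

open Polynomial in
/-- The pair of functionals `p ↦ L (d p)`, where `L` is the umbral functional and `d` is the
reversed denominator of the convergent of index `2m`, respectively `2m + 1`, of the S-fraction. -/
def denFunctional : ℕ → (Qq[X] →ₗ[Qq] Qq) × (Qq[X] →ₗ[Qq] Qq)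
  | 0 => (umbral, umbral)
  | m + 1 =>
    let v := (denFunctional m).2 ∘ₗ LinearMap.mulLeft Qq X + sOdd (m + 1) • (denFunctional m).1
    (v, v + sEven (m + 1) • (denFunctional m).2)

open Polynomial in
/-- The functional attached to the convergent of index `2m`. -/
def evenFunctional (m : ℕ) : Qq[X] →ₗ[Qq] Qq := (denFunctional m).1

open Polynomial in
/-- The functional attached to the convergent of index `2m + 1`. -/
def oddFunctional (m : ℕ) : Qq[X] →ₗ[Qq] Qq := (denFunctional m).2

open Polynomial in
theorem evenFunctional_succ (m : ℕ) (p : Qq[X]) : evenFunctional (m + 1) p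
    = oddFunctional m (X * p) + sOdd (m + 1) * evenFunctional m p := by
  simp [evenFunctional, oddFunctional, denFunctional]

open Polynomial in
theorem oddFunctional_succ (m : ℕ) (p : Qq[X]) : oddFunctional (m + 1) p
    = evenFunctional (m + 1) p + sEven (m + 1) * oddFunctional m p := by
  simp [evenFunctional, oddFunctional, denFunctional]

/-- The constant `∏_{i=1}^m [i] [i+1] / ((q^i + 1) [2i+1])`: the value of `oddFunctional m` on
`qFalling j` is this constant times `umbralFalling j * oddRatio m j`. -/
def oddConst (m : ℕ) : Qq :=
  ∏ i ∈ Finset.range m, qInt (i + 1) * qInt (i + 2) / ((q ^ (i + 1) + 1) * qInt (2 * i + 3))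

theorem oddConst_succ (m : ℕ) : oddConst (m + 1) = oddConst m *
    (qInt (m + 1) * qInt (m + 2) / ((q ^ (m + 1) + 1) * qInt (2 * m + 3))) :=
  Finset.prod_range_succ _ _

/-- The rational identity behind the step to an even index, where `y = q^{m+1}` and `z = q^j`. -/
theorem even_step_identity {K : Type*} [Field K] {p y z : K} (hp : p - 1 ≠ 0)
    (h2 : z * p ^ 2 - 1 ≠ 0) (h3 : z * y * p - 1 ≠ 0) (h4 : z * y * p ^ 2 - 1 ≠ 0)
    (h5 : p * y + 1 ≠ 0) (h6 : y + 1 ≠ 0) (h7 : p * y ^ 2 - 1 ≠ 0) :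
    (y - 1) / (p - 1) * ((p * y - 1) / (p - 1)) / ((y + 1) * ((p * y ^ 2 - 1) / (p - 1)))
        * (-(((z * p - 1) / (p - 1)) ^ 2 / ((z * p ^ 2 - 1) / (p - 1)))
            * (y * (z - 1) * (z * p ^ 2 - 1) / ((z * y * p - 1) * (z * y * p ^ 2 - 1)))
          + (z - 1) / (p - 1) * ((z - y) / (z * y * p - 1)))
      + y * ((p * y - 1) / (p - 1)) ^ 2 / ((p * y + 1) * ((p * y ^ 2 - 1) / (p - 1)))
        * ((y - 1) / (p - 1) * (z - 1) / ((y + 1) * (z * y * p - 1)))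
      = (y - 1) / (p - 1) * ((p * y - 1) / (p - 1)) / ((y + 1) * ((p * y ^ 2 - 1) / (p - 1)))
        * ((z - y) / (z * y * p - 1))
        * ((p * y - 1) / (p - 1) * (z - 1) / ((p * y + 1) * (z * y * p ^ 2 - 1))) := by
  -- With the denominators as atoms, `field_simp` finds them all nonzero.
  generalize e1 : p - 1 = d1 at *
  generalize e2 : z * p ^ 2 - 1 = d2 at *
  generalize e3 : z * y * p - 1 = d3 at *
  generalize e4 : z * y * p ^ 2 - 1 = d4 at *
  generalize e5 : p * y + 1 = d5 at *
  generalize e6 : y + 1 = d6 at *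
  generalize e7 : p * y ^ 2 - 1 = d7 at *
  field_simp
  subst e1 e2 e3 e4 e5 e6 e7
  ring

/-- The rational identity behind the step to an odd index, where `y = q^{m+1}` and `z = q^j`. -/
theorem odd_step_identity {K : Type*} [Field K] {p y z : K} (hp : p - 1 ≠ 0)
    (h3 : z * y * p - 1 ≠ 0) (h6 : y + 1 ≠ 0) (h7 : p * y ^ 2 - 1 ≠ 0) :
    (y - 1) / (p - 1) * (z - 1) / ((y + 1) * (z * y * p - 1))
        + -(((y - 1) / (p - 1)) ^ 2 / ((y + 1) * ((p * y ^ 2 - 1) / (p - 1))))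
      = (y - 1) / (p - 1) * ((p * y - 1) / (p - 1)) / ((y + 1) * ((p * y ^ 2 - 1) / (p - 1)))
        * ((z - y) / (z * y * p - 1)) := by
  generalize e1 : p - 1 = d1 at *
  generalize e3 : z * y * p - 1 = d3 at *
  generalize e6 : y + 1 = d6 at *
  generalize e7 : p * y ^ 2 - 1 = d7 at *
  field_simp
  subst e1 e3 e6 e7
  ring

/-- The value at the even index `2m + 2` from those at the two indices before it. The hypothesis on
`evenFunctional m` is vacuous for `m = 0`, where the functional is `umbral`. -/
theorem evenFunctional_step (m j : ℕ)
    (ho : ∀ j, oddFunctional m (qFalling j) = oddConst m * umbralFalling j * oddRatio m j)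
    (he : ∀ m', m = m' + 1 → evenFunctional m (qFalling j)
      = oddConst m' * umbralFalling j * oddRatio m' j
        * (qInt m * (q ^ j - 1) / ((q ^ m + 1) * (q ^ j * q ^ (m + 1) - 1)))) :
    evenFunctional (m + 1) (qFalling j) = oddConst m * umbralFalling j * oddRatio m j
      * (qInt (m + 1) * (q ^ j - 1) / ((q ^ (m + 1) + 1) * (q ^ j * q ^ (m + 2) - 1))) := by
  have hq := q_sub_one_ne_zero
  rw [evenFunctional_succ, X_mul_qFalling, map_add, map_smul, smul_eq_mul, ho, ho,
    umbralFalling_succ]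
  cases m with
  | zero =>
    have h1 := q_pow_add_one_ne_zero 0
    have h2 := q_pow_sub_one_ne_zero (j + 1)
    have h3 := q_pow_mul_sub_one_ne_zero j 1
    have he0 : evenFunctional 0 (qFalling j) = umbralFalling j := umbral_qFalling j
    have e1 : (q ^ (j + 2) - 1 : Qq) = q ^ j * q ^ 2 - 1 := by ring
    rw [he0, oddRatio_zero, oddRatio_zero, sOdd]
    simp only [oddConst, qInt, Finset.prod_range_zero, zero_add, mul_one, pow_one, one_mul,
      Nat.sub_self, pow_zero, Nat.reduceSub, e1] at *
    generalize umbralFalling j = u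
    rw [pow_succ q j]
    generalize (q ^ j : Qq) = z at *
    field_simp
    ring
  | succ m =>
    have e1 : qInt (m + 1) = (q ^ (m + 1) - 1) / (q - 1) := rfl
    have e2 : qInt (m + 2) = (q * q ^ (m + 1) - 1) / (q - 1) := by rw [qInt]; ring
    have e3 : qInt (2 * m + 3) = (q * (q ^ (m + 1)) ^ 2 - 1) / (q - 1) := by rw [qInt]; ring
    have e4 : qInt j = (q ^ j - 1) / (q - 1) := rfl
    have e5 : qInt (j + 1) = (q ^ j * q - 1) / (q - 1) := by rw [qInt]; ring
    have e6 : qInt (j + 2) = (q ^ j * q ^ 2 - 1) / (q - 1) := by rw [qInt]; ring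
    have e7 : (q ^ j * q ^ (m + 2) : Qq) = q ^ j * q ^ (m + 1) * q := by ring
    have e8 : (q ^ j * q ^ (m + 3) : Qq) = q ^ j * q ^ (m + 1) * q ^ 2 := by ring
    have e9 : (q ^ (m + 2) : Qq) = q * q ^ (m + 1) := by ring
    have h3 := q_pow_mul_sub_one_ne_zero j (m + 1)
    have h4 := q_pow_mul_sub_one_ne_zero j (m + 2)
    have h5 := q_pow_add_one_ne_zero (m + 1)
    have h7 : (q * (q ^ (m + 1)) ^ 2 - 1 : Qq) ≠ 0 := by
      have h := q_pow_sub_one_ne_zero (2 * m + 2)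
      rwa [show (q ^ (2 * m + 2 + 1) : Qq) = q * (q ^ (m + 1)) ^ 2 by ring] at h
    simp only [add_assoc, Nat.reduceAdd] at h3 h4 h5
    rw [e7] at h3
    rw [e8] at h4
    rw [e9] at h5
    have key := even_step_identity hq (q_pow_mul_sub_one_ne_zero j 1) h3 h4 h5
      (q_pow_add_one_ne_zero m) h7
    rw [he m rfl, oddRatio_succ_succ, oddRatio_succ, oddConst_succ, sOdd,
      show 2 * (m + 1 + 1) - 1 = 2 * m + 3 by omega, Nat.add_sub_cancel]
    simp only [add_assoc, Nat.reduceAdd, e1, e2, e3, e4, e5, e6, e7, e8]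
    rw [e9]
    linear_combination oddConst m * umbralFalling j * oddRatio m j * key

theorem oddFunctional_step (m j : ℕ)
    (ho : oddFunctional m (qFalling j) = oddConst m * umbralFalling j * oddRatio m j)
    (he : evenFunctional (m + 1) (qFalling j) = oddConst m * umbralFalling j * oddRatio m j
      * (qInt (m + 1) * (q ^ j - 1) / ((q ^ (m + 1) + 1) * (q ^ j * q ^ (m + 2) - 1)))) :
    oddFunctional (m + 1) (qFalling j)
      = oddConst (m + 1) * umbralFalling j * oddRatio (m + 1) j := by
  have e2 : qInt (m + 2) = (q * q ^ (m + 1) - 1) / (q - 1) := by rw [qInt]; ring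
  have e3 : qInt (2 * m + 3) = (q * (q ^ (m + 1)) ^ 2 - 1) / (q - 1) := by rw [qInt]; ring
  have e7 : (q ^ j * q ^ (m + 2) : Qq) = q ^ j * q ^ (m + 1) * q := by ring
  have h3 : (q ^ j * q ^ (m + 2) - 1 : Qq) ≠ 0 := q_pow_mul_sub_one_ne_zero j (m + 1)
  have h7 : (q * (q ^ (m + 1)) ^ 2 - 1 : Qq) ≠ 0 := by
    have h := q_pow_sub_one_ne_zero (2 * m + 2)
    rwa [show (q ^ (2 * m + 2 + 1) : Qq) = q * (q ^ (m + 1)) ^ 2 by ring] at h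
  rw [e7] at h3
  have key := odd_step_identity q_sub_one_ne_zero h3 (q_pow_add_one_ne_zero m) h7
  rw [oddFunctional_succ, he, ho, oddConst_succ, oddRatio_succ, sEven,
    show 2 * (m + 1) + 1 = 2 * m + 3 by omega, e2, e3, e7, qInt]
  linear_combination oddConst m * umbralFalling j * oddRatio m j * key

/-- Closed forms of the functionals on `q`-falling factorials. The even one is stated from index
`2` on, where it is a multiple of the odd value preceding it. -/
theorem functional_qFalling (m : ℕ) :
    (∀ j, oddFunctional m (qFalling j) = oddConst m * umbralFalling j * oddRatio m j) ∧
    ∀ j, evenFunctional (m + 1) (qFalling j) = oddConst m * umbralFalling j * oddRatio m j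
      * (qInt (m + 1) * (q ^ j - 1) / ((q ^ (m + 1) + 1) * (q ^ j * q ^ (m + 2) - 1))) := by
  induction m with
  | zero =>
    have ho (j : ℕ) :
        oddFunctional 0 (qFalling j) = oddConst 0 * umbralFalling j * oddRatio 0 j := by
      exact (umbral_qFalling j).trans (by simp [oddConst, oddRatio])
    exact ⟨ho, fun j => evenFunctional_step 0 j ho fun m' h => absurd h (by omega)⟩
  | succ m ih =>
    have ho (j : ℕ) := oddFunctional_step m j (ih.1 j) (ih.2 j)
    refine ⟨ho, fun j => evenFunctional_step (m + 1) j ho fun m' h => ?_⟩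
    obtain rfl : m = m' := by omega
    exact ih.2 j

/-! ### Orthogonality -/

open Polynomial in
theorem evenFunctional_X_pow_mul_qFalling (m k : ℕ) :
    ∀ j, k + j < m → evenFunctional m (X ^ k * qFalling j) = 0 := by
  induction k with
  | zero =>
    intro j hj
    obtain ⟨m, rfl⟩ : ∃ m', m = m' + 1 := ⟨m - 1, by omega⟩
    rw [pow_zero, one_mul, (functional_qFalling m).2]
    rcases Nat.eq_zero_or_pos j with rfl | hj0
    · simp
    · rw [oddRatio_eq_zero hj0 (by omega), mul_zero, zero_mul]
  | succ k ih =>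
    intro j hj
    rw [pow_succ, mul_assoc, X_mul_qFalling, mul_add, mul_smul_comm, map_add, map_smul,
      ih _ (by omega), ih _ (by omega), smul_zero, add_zero]

open Polynomial in
theorem oddFunctional_X_pow_mul_qFalling (m k : ℕ) :
    ∀ j, 1 ≤ j → k + j ≤ m → oddFunctional m (X ^ k * qFalling j) = 0 := by
  induction k with
  | zero =>
    intro j hj hjm
    rw [pow_zero, one_mul, (functional_qFalling m).1, oddRatio_eq_zero hj (by omega), mul_zero]
  | succ k ih =>
    intro j hj hjm
    rw [pow_succ, mul_assoc, X_mul_qFalling, mul_add, mul_smul_comm, map_add, map_smul,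
      ih _ (by omega) (by omega), ih _ hj (by omega), smul_zero, add_zero]

open Polynomial in
/-- Orthogonality of the even denominators with respect to the moments `β_n`. -/
theorem evenFunctional_X_pow {m k : ℕ} (h : k < m) : evenFunctional m (X ^ k) = 0 := by
  simpa [qFalling_zero] using evenFunctional_X_pow_mul_qFalling m k 0 h

open Polynomial in
/-- Orthogonality of the odd denominators with respect to the shifted moments `β_{n+1}`. -/
theorem oddFunctional_X_pow_succ {m k : ℕ} (h : k < m) :
    oddFunctional m (X ^ (k + 1)) = 0 := by
  simpa [qFalling_one, pow_succ] using oddFunctional_X_pow_mul_qFalling m k 1 le_rfl h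

/-! ### Convergents of formal continued fractions -/

theorem contFrac_s_get (a b : ℕ → Qq⸨X⸩) (n : ℕ) :
    (contFrac a b).s.get? n = some ⟨a n, b n⟩ := rfl

theorem contFrac_nums_one (a b : ℕ → Qq⸨X⸩) : (contFrac a b).nums 1 = a 0 := by
  rw [GenContFract.first_num_eq (contFrac_s_get a b 0)]
  simp [contFrac]

theorem contFrac_dens_one (a b : ℕ → Qq⸨X⸩) : (contFrac a b).dens 1 = b 0 :=
  GenContFract.first_den_eq (contFrac_s_get a b 0)

theorem contFrac_nums_succ (a b : ℕ → Qq⸨X⸩) (n : ℕ) : (contFrac a b).nums (n + 2)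
    = b (n + 1) * (contFrac a b).nums (n + 1) + a (n + 1) * (contFrac a b).nums n :=
  GenContFract.nums_recurrence (gp := ⟨a (n + 1), b (n + 1)⟩) (contFrac_s_get a b (n + 1)) rfl rfl

theorem contFrac_dens_succ (a b : ℕ → Qq⸨X⸩) (n : ℕ) : (contFrac a b).dens (n + 2)
    = b (n + 1) * (contFrac a b).dens (n + 1) + a (n + 1) * (contFrac a b).dens n :=
  GenContFract.dens_recurrence (gp := ⟨a (n + 1), b (n + 1)⟩) (contFrac_s_get a b (n + 1)) rfl rfl

theorem sFrac_nums_succ (c : ℕ → Qq) (n : ℕ) : (sFrac c).nums (n + 2)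
    = (sFrac c).nums (n + 1) + HahnSeries.C (c (n + 1)) * x * (sFrac c).nums n := by
  simp [sFrac, contFrac_nums_succ]

theorem sFrac_dens_succ (c : ℕ → Qq) (n : ℕ) : (sFrac c).dens (n + 2)
    = (sFrac c).dens (n + 1) + HahnSeries.C (c (n + 1)) * x * (sFrac c).dens n := by
  simp [sFrac, contFrac_dens_succ]

/-- The denominators of an S-fraction are power series with constant term `1`. -/
theorem exists_sFrac_dens (c : ℕ → Qq) (n : ℕ) : ∃ D : PowerSeries Qq,
    PowerSeries.constantCoeff D = 1 ∧ (sFrac c).dens n = (D : Qq⸨X⸩) := by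
  induction n using Nat.twoStepInduction with
  | zero => exact ⟨1, by simp, by simp⟩
  | one => exact ⟨1, by simp, by simp [sFrac, contFrac_dens_one]⟩
  | more n ih1 ih2 =>
    obtain ⟨D1, h1, e1⟩ := ih1
    obtain ⟨D2, h2, e2⟩ := ih2
    refine ⟨D2 + PowerSeries.C (c (n + 1)) * PowerSeries.X * D1, by simp [h2], ?_⟩
    rw [sFrac_dens_succ, e1, e2, PowerSeries.coe_add, PowerSeries.coe_mul, PowerSeries.coe_mul,
      PowerSeries.coe_C, x]

/-! ### Remainders of the convergents -/

/-- The remainder `B̂ · (denominator) - (numerator)` of the `n`-th convergent. -/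
def remainder (n : ℕ) : Qq⸨X⸩ :=
  (sFrac sCoeff).dens n * Bhat - (sFrac sCoeff).nums n

theorem remainder_succ (n : ℕ) : remainder (n + 2)
    = remainder (n + 1) + HahnSeries.C (sCoeff (n + 1)) * x * remainder n := by
  simp only [remainder, sFrac_nums_succ, sFrac_dens_succ]
  ring

/-- The generating function of the moments of `evenFunctional m`. -/
def evenSeries (m : ℕ) : PowerSeries Qq :=
  PowerSeries.mk fun j => evenFunctional m (Polynomial.X ^ j)

/-- The generating function of the moments of `oddFunctional m`, the moment of order `0` left
out. -/
def oddSeries (m : ℕ) : PowerSeries Qq :=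
  PowerSeries.mk fun j => oddFunctional m (Polynomial.X ^ (j + 1))

theorem evenSeries_succ (m : ℕ) : evenSeries (m + 1)
    = oddSeries m + PowerSeries.C (sOdd (m + 1)) * evenSeries m := by
  ext j
  simp [evenSeries, oddSeries, evenFunctional_succ, pow_succ']

/-- The moment of order `0` of `evenFunctional (m + 1)` vanishes by orthogonality, which is what
makes the recurrence close up. -/
theorem X_mul_oddSeries_succ (m : ℕ) : PowerSeries.X * oddSeries (m + 1)
    = evenSeries (m + 1) + PowerSeries.C (sEven (m + 1)) * PowerSeries.X * oddSeries m := by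
  ext j
  cases j with
  | zero =>
    have h : evenFunctional (m + 1) 1 = 0 := by
      simpa using evenFunctional_X_pow (Nat.succ_pos m)
    simp [evenSeries, h, mul_assoc]
  | succ j =>
    simp [evenSeries, oddSeries, mul_assoc, PowerSeries.coeff_succ_X_mul, oddFunctional_succ]

/-- The factor `x^m` comes from reversing the denominator, of degree at most `m`; in the odd case
one more factor comes from the moment of order `0`, which the numerator cancels. -/
theorem remainder_eq (m : ℕ) :
    remainder (2 * m) = ((PowerSeries.X ^ m * evenSeries m : PowerSeries Qq) : Qq⸨X⸩) ∧
    remainder (2 * m + 1)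
      = ((PowerSeries.X ^ (m + 1) * oddSeries m : PowerSeries Qq) : Qq⸨X⸩) := by
  induction m with
  | zero =>
    have h0 : evenSeries 0 = PowerSeries.mk beta := by
      ext j
      have h : evenFunctional 0 (Polynomial.X ^ j) = beta j := umbral_X_pow j
      simp [evenSeries, h]
    have h1 : PowerSeries.mk beta = PowerSeries.X * oddSeries 0 + 1 := by
      ext j
      cases j with
      | zero =>
        have := umbral_qFalling 0
        rw [qFalling_zero, ← pow_zero Polynomial.X, umbral_X_pow] at this
        simp [this, umbralFalling, qInt_one]
      | succ j =>
        have h : oddFunctional 0 (Polynomial.X ^ (j + 1)) = beta (j + 1) := umbral_X_pow (j + 1)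
        simp [oddSeries, PowerSeries.coeff_succ_X_mul, PowerSeries.coeff_one, h]
    constructor
    · simp [remainder, h0, Bhat, sFrac, contFrac]
    · have e : remainder 1 = Bhat - 1 := by
        simp [remainder, sFrac, contFrac_nums_one, contFrac_dens_one]
      rw [Nat.mul_zero, zero_add, e, Bhat, h1, PowerSeries.coe_add]
      simp
  | succ m ih =>
    have hev : remainder (2 * (m + 1))
        = ((PowerSeries.X ^ (m + 1) * evenSeries (m + 1) : PowerSeries Qq) : Qq⸨X⸩) := by
      have hc : sCoeff (2 * m + 1) = sOdd (m + 1) := sCoeff_odd (m + 1) (by omega)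
      rw [show 2 * (m + 1) = 2 * m + 2 by ring, remainder_succ, ih.1, ih.2, hc, x,
        ← PowerSeries.coe_C, ← PowerSeries.coe_mul, ← PowerSeries.coe_mul, ← PowerSeries.coe_add,
        evenSeries_succ]
      congr 1
      ring
    refine ⟨hev, ?_⟩
    have hc : sCoeff (2 * m + 1 + 1) = sEven (m + 1) := sCoeff_even (m + 1)
    rw [show 2 * (m + 1) + 1 = 2 * m + 1 + 2 by ring, remainder_succ, ih.2, hc, x,
      show 2 * m + 1 + 1 = 2 * (m + 1) by ring, hev,
      ← PowerSeries.coe_C, ← PowerSeries.coe_mul, ← PowerSeries.coe_mul, ← PowerSeries.coe_add]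
    congr 1
    linear_combination (-(PowerSeries.X : PowerSeries Qq) ^ (m + 1)) * X_mul_oddSeries_succ m

/-- The two power-series factors are divisible by `x^m`, by orthogonality, so the remainder of the
`n`-th convergent is divisible by `x^n`. -/
theorem exists_remainder_eq (n : ℕ) : ∃ H : PowerSeries Qq,
    remainder n = ((PowerSeries.X ^ n * H : PowerSeries Qq) : Qq⸨X⸩) := by
  obtain ⟨m, rfl | rfl⟩ := n.even_or_odd'
  · obtain ⟨H, hH⟩ : PowerSeries.X ^ m ∣ evenSeries m :=
      PowerSeries.X_pow_dvd_iff.mpr fun k hk => by simp [evenSeries, evenFunctional_X_pow hk]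
    exact ⟨H, by rw [(remainder_eq m).1, hH, two_mul, pow_add, mul_assoc]⟩
  · obtain ⟨H, hH⟩ : PowerSeries.X ^ m ∣ oddSeries m :=
      PowerSeries.X_pow_dvd_iff.mpr fun k hk => by simp [oddSeries, oddFunctional_X_pow_succ hk]
    refine ⟨H, ?_⟩
    rw [(remainder_eq m).2, hH, ← mul_assoc, ← pow_add]
    congr 3
    omega

/-! ### Convergence of the S-fraction -/

/-- Congruence modulo `x^n` of the `n`-th term with `f`, for every `n`, implies `x`-adic
convergence to `f`. -/
theorem tendsto_of_sub_eq_X_pow_mul (u : ℕ → Qq⸨X⸩) (f : Qq⸨X⸩)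
    (h : ∀ n, ∃ W : PowerSeries Qq,
      u n - f = ((PowerSeries.X ^ n * W : PowerSeries Qq) : Qq⸨X⸩)) :
    Filter.Tendsto u Filter.atTop (𝓝 f) := by
  refine Filter.tendsto_def.mpr fun s hs => ?_
  obtain ⟨γ, hγ⟩ := Valued.mem_nhds.mp hs
  set g := MonoidWithZeroHom.ValueGroup₀.embedding γ.1 with hg
  have hg0 : g ≠ 0 := by simp [hg]
  obtain ⟨N, hN⟩ : ∃ N : ℕ, -WithZero.log g < N := by
    obtain ⟨N, hN⟩ := exists_nat_gt (-WithZero.log g)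
    exact ⟨N, by simpa using hN⟩
  filter_upwards [Filter.eventually_ge_atTop N] with n hn
  apply hγ
  obtain ⟨W, hW⟩ := h n
  refine Valued.v.restrict_lt_iff_lt_embedding.mpr
    (lt_of_le_of_lt (b := WithZero.exp (-n : ℤ)) ?_ ?_)
  · rw [hW, LaurentSeries.intValuation_le_iff_coeff_lt_eq_zero]
    exact PowerSeries.X_pow_dvd_iff.mp ⟨W, rfl⟩
  · rw [← hg, ← WithZero.lt_log_iff_exp_lt hg0]
    omega

theorem sFrac_hasValue : HasValue (sFrac sCoeff) Bhat := by
  refine tendsto_of_sub_eq_X_pow_mul _ _ fun n => ?_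
  obtain ⟨D, hD, eD⟩ := exists_sFrac_dens sCoeff n
  obtain ⟨H, hH⟩ := exists_remainder_eq n
  have hD0 : D ≠ 0 := by
    rintro rfl
    simp at hD
  have hD1 : (D : Qq⸨X⸩) ≠ 0 := fun h =>
    hD0 (HahnSeries.ofPowerSeries_injective (h.trans (map_zero _).symm))
  have hDD : (D : Qq⸨X⸩) * ((D⁻¹ : PowerSeries Qq) : Qq⸨X⸩) = 1 := by
    rw [← PowerSeries.coe_mul, PowerSeries.mul_inv_cancel _ (by rw [hD]; exact one_ne_zero),
      PowerSeries.coe_one]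
  refine ⟨-(H * D⁻¹), mul_left_cancel₀ hD1 ?_⟩
  rw [remainder, eD] at hH
  rw [GenContFract.conv_eq_num_div_den, eD, mul_sub, mul_div_cancel₀ _ hD1]
  rw [PowerSeries.coe_mul] at hH
  rw [mul_neg, PowerSeries.coe_neg, ← mul_assoc, PowerSeries.coe_mul, PowerSeries.coe_mul]
  linear_combination -hH + (HahnSeries.ofPowerSeries ℤ Qq (PowerSeries.X ^ n))
    * (HahnSeries.ofPowerSeries ℤ Qq H) * hDD

/-! ### Equivalence with the unnormalized fraction -/

/-- Multiplying each level of a continued fraction by a nonzero factor does not change its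
convergents; here the factors normalize the partial denominators `b n` to `1`. -/
theorem contFrac_convs_eq (a b c : ℕ → Qq⸨X⸩) (hb : ∀ n, b n ≠ 0) (h0 : a 0 = b 0 * c 0)
    (h : ∀ n, a (n + 1) = c (n + 1) * b n * b (n + 1)) (n : ℕ) :
    (contFrac a b).convs n = (contFrac c fun _ => 1).convs n := by
  have hn (n : ℕ) : (contFrac a b).nums n
        = (∏ i ∈ Finset.range n, b i) * (contFrac c fun _ => 1).nums n ∧
      (contFrac a b).dens n
        = (∏ i ∈ Finset.range n, b i) * (contFrac c fun _ => 1).dens n := by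
    induction n using Nat.twoStepInduction with
    | zero => simp [contFrac]
    | one => simp [contFrac_nums_one, contFrac_dens_one, h0]
    | more n ih1 ih2 =>
      simp only [contFrac_nums_succ, contFrac_dens_succ, ih1, ih2, h, Finset.prod_range_succ]
      constructor <;> ring
  rw [GenContFract.conv_eq_num_div_den, GenContFract.conv_eq_num_div_den, (hn n).1, (hn n).2,
    mul_div_mul_left _ _ (Finset.prod_ne_zero_iff.mpr fun i _ => hb i)]

theorem partDen_odd (m : ℕ) :
    partDen (2 * m + 1) = HahnSeries.C ((q ^ (m + 1) + 1) / qInt (m + 1)) := by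
  rw [partDen, if_pos ⟨m, rfl⟩, show (2 * m + 1 + 1) / 2 = m + 1 by omega]

theorem partDen_even (m : ℕ) : partDen (2 * m) = HahnSeries.C (qInt (2 * m + 1)) := by
  rw [partDen, if_neg (by simp)]

theorem partDen_ne_zero (n : ℕ) : partDen n ≠ 0 := by
  obtain ⟨m, rfl | rfl⟩ := n.even_or_odd'
  · rw [partDen_even]
    exact HahnSeries.C_ne_zero (qInt_succ_ne_zero _)
  · rw [partDen_odd]
    exact HahnSeries.C_ne_zero (div_ne_zero (q_pow_add_one_ne_zero m) (qInt_succ_ne_zero m))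

theorem partNum_succ (n : ℕ) : partNum (n + 1)
    = HahnSeries.C (sCoeff (n + 1)) * x * partDen n * partDen (n + 1) := by
  obtain ⟨m, rfl | rfl⟩ := n.even_or_odd'
  · have h1 := q_pow_add_one_ne_zero m
    have h2 := qInt_succ_ne_zero m
    have h3 := qInt_succ_ne_zero (2 * m)
    have e : q ^ m * qInt (m + 1) = sOdd (m + 1) * qInt (2 * m + 1)
        * ((q ^ (m + 1) + 1) / qInt (m + 1)) := by
      rw [sOdd, show 2 * (m + 1) - 1 = 2 * m + 1 by omega, Nat.add_sub_cancel]
      field_simp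
    have hc : sCoeff (2 * m + 1) = sOdd (m + 1) := sCoeff_odd (m + 1) (by omega)
    rw [partDen_odd, partDen_even, hc, partNum, if_neg (by omega), if_pos ⟨m, rfl⟩,
      show (2 * m + 1 + 1) / 2 = m + 1 by omega, Nat.add_sub_cancel, e, map_mul, map_mul]
    ring
  · have h1 := q_pow_add_one_ne_zero m
    have h2 := qInt_succ_ne_zero m
    have h3 := qInt_succ_ne_zero (2 * m + 2)
    have e : -qInt (m + 1) = sEven (m + 1) * ((q ^ (m + 1) + 1) / qInt (m + 1))
        * qInt (2 * m + 2 + 1) := by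
      rw [sEven, show 2 * (m + 1) + 1 = 2 * m + 2 + 1 by omega]
      field_simp
    have hc : sCoeff (2 * m + 1 + 1) = sEven (m + 1) := sCoeff_even (m + 1)
    have hd : partDen (2 * m + 1 + 1) = HahnSeries.C (qInt (2 * m + 2 + 1)) :=
      partDen_even (m + 1)
    have ho : ¬ Odd (2 * m + 1 + 1) := by
      rw [show 2 * m + 1 + 1 = 2 * (m + 1) by ring]
      simp
    rw [partDen_odd, hd, hc, partNum, if_neg (by omega), if_neg ho,
      show (2 * m + 1 + 1) / 2 = m + 1 by omega, e, map_mul, map_mul]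
    ring

end QBernoulli

end

/-- The formal power series `∑ β_n x^n` of the Carlitz `q`-Bernoulli numbers is the value of
`1 / ([1] + x / ((q+1)/[1] - x / ([3] + q [2] x / ((q^2+1)/[2] - [2] x / ([5] + ⋯)))))`,
and in normalized form of the S-fraction with coefficients `sCoeff`. -/
theorem mainTheorem6 :
    QBernoulli.HasValue (QBernoulli.contFrac QBernoulli.partNum QBernoulli.partDen)
        QBernoulli.Bhat ∧
      QBernoulli.HasValue (QBernoulli.sFrac QBernoulli.sCoeff) QBernoulli.Bhat := by
  refine ⟨?_, QBernoulli.sFrac_hasValue⟩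
  have h := QBernoulli.sFrac_hasValue
  unfold QBernoulli.HasValue at h ⊢
  refine h.congr fun n => (QBernoulli.contFrac_convs_eq _ _ _ QBernoulli.partDen_ne_zero ?_ ?_
    n).symm
  · simp [QBernoulli.partNum, QBernoulli.partDen, QBernoulli.qInt_one]
  · intro n
    simpa using QBernoulli.partNum_succ n
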